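/- Let $\mathfrak{S}_n$ be the set of permutations $\pi=\pi_1\pi_2\cdots\pi_n$ of $\{1,\dots,n\}$, and let $\mathrm{inv}(w)$ denote the number of inversions of a word $w=w_1\cdots w_m$, i.e. of pairs $i<j$ with $w_i>w_j$. For an integer $r\ge 1$ put $r\mathsf{Des}(\pi)=\{i : 1\le i\le n-1,\ \pi_i\ge \pi_{i+1}+r\}$, $r\mathsf{des}(\pi)=|r\mathsf{Des}(\pi)|$ and $$r\mathsf{maj}(\pi)=\sum_{i\in r\mathsf{Des}(\pi)} i+\bigl|\{(i,j) : i<j,\ \pi_j<\pi_i<\pi_j+r\}\bigr|.$$ For integers $g,\ell\ge 1$ put $g\mathsf{exc}_\ell(\pi)=|\{i : \pi_i\ge i+g,\ i\ge \ell\}|$ and $g\mathsf{Excp}_\ell(\pi)=\{i : \pi_i\ge i+g,\ \pi_i\ge \ell\}$. Let $g\mathsf{Exc}_\ell(\pi)$ be the subword of $\pi$ formed by the letters $\pi_i$ with $i\in g\mathsf{Excp}_\ell(\pi)$ and $g\mathsf{Nexc}_\ell(\pi)$ the subword formed by the remaining letters, both in their order in $\pi$, and put $$g\mathsf{den}_\ell(\pi)=\sum_{i\in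 g\mathsf{Excp}_\ell(\pi)}(i+g-1)+\mathrm{inv}(g\mathsf{Exc}_\ell(\pi))+\mathrm{inv}(g\mathsf{Nexc}_\ell(\pi)).$$ Theorem (conjectured by Liu). For all integers $g,\ell\ge 1$ the pair $(g\mathsf{exc}_\ell,g\mathsf{den}_\ell)$ is $r$-Euler-Mahonian with $r=g+\ell-1$; that is, for every $n$, as polynomials in $t$ and $q$, $$\sum_{\pi\in\mathfrak{S}_n}t^{\,g\mathsf{exc}_\ell(\pi)}q^{\,g\mathsf{den}_\ell(\pi)}=\sum_{\pi\in\mathfrak{S}_n}t^{\,r\mathsf{des}(\pi)}q^{\,r\mathsf{maj}(\pi)}.$$ -/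

import Mathlib

/-!
Write `[k] = 1 + q + ⋯ + q ^ (k - 1)`. Both generating polynomials, divided by
`(1 - t) (1 - q t) ⋯ (1 - q ^ n t)`, turn out to be the power series in `t` whose coefficient of
`t ^ x` is `∏ [x + min r i]`, the product running over `i = 1, …, n`.

For `(rdes, rmaj)`, insert the largest letter. Exactly `rdes π + min r n` of the `n` slots leave
`rdes` unchanged; label these from right to left, and then the other slots from left to right, by
`0, …, n - 1`. Inserting into the slot with label `c` raises `rmaj` by `c`, so the series for `n`
is a `q`-difference of the series for `n - 1`, and each insertion contributes a factor
`[x + min r n]`.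

For `(gexc, gden)`, let `τ j` be the least letter that makes the place `j` an excedance. Summing
over the places `j` the number of earlier letters that lie cyclically after the letter of `j` and
before `τ j` gives `gden`. Both statistics therefore make sense for every monotone sequence of
thresholds, and this larger class is closed under deleting the last letter `v`, which lowers by one
every threshold above `v`. The places before `L = ℓ - 1` are not counted by `gexc` and give the
factors `[x + 1] ⋯ [x + L]`; the others give the product `∏ [x + τ (L + k) - k]` of Goldman, Joichi
and White for the Ferrers board with columns `τ L ≤ τ (L + 1) ≤ ⋯`. For the thresholds of `gden`,
reading the latter product backwards turns its factors into `[x + min r i]` with `r = g + L`.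
-/

open Finset

/-- The place `i ∈ {1, …, n}` (counted from `1`) that the index `i : Fin n` stands for. -/
def place {n : ℕ} (i : Fin n) : ℕ := (i : ℕ) + 1

/-- The letter `π_i ∈ {1, …, n}` (counted from `1`) of the permutation `π = π₁ π₂ ⋯ πₙ`. -/
def letter {n : ℕ} (π : Equiv.Perm (Fin n)) (i : Fin n) : ℕ := (π i : ℕ) + 1

/-- The set of inversions of `π`: the pairs `(i, j)` with `i < j` and `π_i > π_j`. -/
def invSet {n : ℕ} (π : Equiv.Perm (Fin n)) : Finset (Fin n × Fin n) :=
  univ.filter fun p => p.1 < p.2 ∧ letter π p.2 < letter π p.1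

/-- The number of inversions of the subword of `π` formed by the letters in the places of `S`,
read from left to right. -/
def invOn {n : ℕ} (π : Equiv.Perm (Fin n)) (S : Finset (Fin n)) : ℕ :=
  #((invSet π).filter fun p => p.1 ∈ S ∧ p.2 ∈ S)

/-- The `r`-descent set: the places `i ∈ {1, …, n - 1}` with `π_i ≥ π_{i+1} + r`. -/
def rDes (r : ℕ) {n : ℕ} (π : Equiv.Perm (Fin n)) : Finset (Fin n) :=
  univ.filter fun i => ∃ j : Fin n, place j = place i + 1 ∧ letter π j + r ≤ letter π i

/-- The `r`-inversion set: the inversions `(i, j)` with `π_i < π_j + r`. -/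
def rInv (r : ℕ) {n : ℕ} (π : Equiv.Perm (Fin n)) : Finset (Fin n × Fin n) :=
  (invSet π).filter fun p => letter π p.1 < letter π p.2 + r

/-- The `r`-descent number. -/
def rdes (r : ℕ) {n : ℕ} (π : Equiv.Perm (Fin n)) : ℕ := #(rDes r π)

/-- The `r`-major index. -/
def rmaj (r : ℕ) {n : ℕ} (π : Equiv.Perm (Fin n)) : ℕ :=
  (∑ i ∈ rDes r π, place i) + #(rInv r π)

/-- The set of `g`-gap `ℓ`-level excedance places: those `i` with `π_i ≥ i + g` and `π_i ≥ ℓ`. -/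
def gExcp (g ℓ : ℕ) {n : ℕ} (π : Equiv.Perm (Fin n)) : Finset (Fin n) :=
  univ.filter fun i => place i + g ≤ letter π i ∧ ℓ ≤ letter π i

/-- The set of places that are not `g`-gap `ℓ`-level excedance places. -/
def gNexcp (g ℓ : ℕ) {n : ℕ} (π : Equiv.Perm (Fin n)) : Finset (Fin n) :=
  (gExcp g ℓ π)ᶜ

/-- The `g`-gap `ℓ`-level Denert statistic. Here `i + g - 1` is never
truncated, since `i ≥ 1`. -/
def gden (g ℓ : ℕ) {n : ℕ} (π : Equiv.Perm (Fin n)) : ℕ :=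
  (∑ i ∈ gExcp g ℓ π, (place i + g - 1)) + invOn π (gExcp g ℓ π) + invOn π (gNexcp g ℓ π)

/-- The `g`-gap `ℓ`-level excedance number: the number of `i ≥ ℓ` with `π_i ≥ i + g`. -/
def gexc (g ℓ : ℕ) {n : ℕ} (π : Equiv.Perm (Fin n)) : ℕ :=
  #(univ.filter fun i : Fin n => place i + g ≤ letter π i ∧ ℓ ≤ place i)

/-- The generating polynomial `∑_{π ∈ 𝔖ₙ} t ^ st₁(π) * q ^ st₂(π)` of a pair of statistics,
with `t = X 0` and `q = X 1`. -/
noncomputable def jointGenPoly (st₁ st₂ : ∀ {n : ℕ}, Equiv.Perm (Fin n) → ℕ) (n : ℕ) :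
    MvPolynomial (Fin 2) ℤ :=
  ∑ π : Equiv.Perm (Fin n), MvPolynomial.X 0 ^ st₁ π * MvPolynomial.X 1 ^ st₂ π

/-- A pair of permutation statistics is `r`-Euler-Mahonian if, over every `𝔖ₙ`, it has the same
joint generating polynomial as the pair of the `r`-descent number and the `r`-major index. -/
def IsEulerMahonian (r : ℕ) (st₁ st₂ : ∀ {n : ℕ}, Equiv.Perm (Fin n) → ℕ) : Prop :=
  ∀ n : ℕ, jointGenPoly st₁ st₂ n = jointGenPoly (rdes r) (rmaj r) n

section QNumbers

variable {R : Type*} [CommRing R]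

/-- The `q`-analogue `1 + q + ⋯ + q ^ (k - 1)` of the natural number `k`. -/
def qNumber (q : R) (k : ℕ) : R := ∑ i ∈ range k, q ^ i

variable (q : R)

@[simp] lemma qNumber_zero : qNumber q 0 = 0 := by simp [qNumber]

lemma qNumber_add (a b : ℕ) : qNumber q (a + b) = qNumber q a + q ^ a * qNumber q b := by
  simp [qNumber, sum_range_add, mul_sum, pow_add]

lemma one_sub_mul_qNumber (k : ℕ) : (1 - q) * qNumber q k = 1 - q ^ k :=
  mul_neg_geom_sum q k

lemma sum_range_pow_add (a k : ℕ) : ∑ c ∈ range k, q ^ (a + c) = q ^ a * qNumber q k := by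
  simp [qNumber, mul_sum, pow_add]

lemma sum_range_pow_sub (k : ℕ) : ∑ v ∈ range k, q ^ (k - 1 - v) = qNumber q k :=
  sum_range_reflect (q ^ ·) k

end QNumbers

section InsertLetter

variable {N : ℕ}

/-- The permutation of `N + 1` letters obtained from `π` by putting the letter `y` in a new
place `x`; the old places and letters are renumbered so as to avoid `x` and `y`. -/
def insertLetter (x y : Fin (N + 1)) (π : Equiv.Perm (Fin N)) : Equiv.Perm (Fin (N + 1)) :=
  (finSuccEquiv' x).trans ((Equiv.optionCongr π).trans (finSuccEquiv' y).symm)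

@[simp] lemma insertLetter_self (x y : Fin (N + 1)) (π : Equiv.Perm (Fin N)) :
    insertLetter x y π x = y := by
  simp [insertLetter]

@[simp] lemma insertLetter_succAbove (x y : Fin (N + 1)) (π : Equiv.Perm (Fin N)) (i : Fin N) :
    insertLetter x y π (x.succAbove i) = y.succAbove (π i) := by
  simp [insertLetter]

lemma insertLetter_last_castSucc (y : Fin (N + 1)) (π : Equiv.Perm (Fin N)) (i : Fin N) :
    insertLetter (Fin.last N) y π i.castSucc = y.succAbove (π i) := by
  rw [← Fin.succAbove_last_apply, insertLetter_succAbove]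

lemma val_succAbove (x : Fin (N + 1)) (i : Fin N) :
    (x.succAbove i : ℕ) = if (i : ℕ) < x then (i : ℕ) else i + 1 := by
  rw [Fin.succAbove]
  split_ifs <;> first | rfl | contradiction

lemma bijective_insertLetter_letter (y : Fin (N + 1)) :
    Function.Bijective fun p : Equiv.Perm (Fin N) × Fin (N + 1) => insertLetter p.2 y p.1 := by
  refine (Fintype.bijective_iff_injective_and_card _).2 ⟨?_, ?_⟩
  · rintro ⟨π, x⟩ ⟨π', x'⟩ h
    replace h : insertLetter x y π = insertLetter x' y π' := h
    obtain rfl : x = x' := (insertLetter x' y π').injective <| by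
      rw [insertLetter_self, ← h, insertLetter_self]
    refine Prod.ext (Equiv.ext fun i => y.succAbove_right_injective ?_) rfl
    rw [← insertLetter_succAbove, ← insertLetter_succAbove, h]
  · simp [Fintype.card_perm, Nat.factorial_succ, mul_comm]

lemma bijective_insertLetter_place (x : Fin (N + 1)) :
    Function.Bijective fun p : Equiv.Perm (Fin N) × Fin (N + 1) => insertLetter x p.2 p.1 := by
  refine (Fintype.bijective_iff_injective_and_card _).2 ⟨?_, ?_⟩
  · rintro ⟨π, y⟩ ⟨π', y'⟩ h
    replace h : insertLetter x y π = insertLetter x y' π' := h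
    obtain rfl : y = y' := by rw [← insertLetter_self x y π, h, insertLetter_self]
    refine Prod.ext (Equiv.ext fun i => y.succAbove_right_injective ?_) rfl
    rw [← insertLetter_succAbove, ← insertLetter_succAbove, h]
  · simp [Fintype.card_perm, Nat.factorial_succ, mul_comm]

variable {M : Type*} [AddCommMonoid M]

lemma sum_perm_succ_insertLetter_letter (y : Fin (N + 1)) (F : Equiv.Perm (Fin (N + 1)) → M) :
    ∑ σ, F σ = ∑ π, ∑ x, F (insertLetter x y π) := by
  rw [← (bijective_insertLetter_letter y).sum_comp, Fintype.sum_prod_type]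

lemma sum_perm_succ_insertLetter_place (x : Fin (N + 1)) (F : Equiv.Perm (Fin (N + 1)) → M) :
    ∑ σ, F σ = ∑ y, ∑ π, F (insertLetter x y π) := by
  rw [← (bijective_insertLetter_place x).sum_comp, Fintype.sum_prod_type_right]

end InsertLetter

section GeneratingSeries

open PowerSeries

variable {R : Type*} [CommRing R]

/-- The generating series `∑_π t ^ st₁(π) * q ^ st₂(π)` over `𝔖ₙ`, as a power series in `t`. -/
noncomputable def genSeries (q : R) {n : ℕ} (st₁ st₂ : Equiv.Perm (Fin n) → ℕ) : R⟦X⟧ :=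
  ∑ π, X ^ st₁ π * C (q ^ st₂ π)

/-- The `q`-Pochhammer symbol `(1 - t) (1 - q t) ⋯ (1 - q ^ (m - 1) t)`. -/
noncomputable def qPoch (q : R) (m : ℕ) : R⟦X⟧ := ∏ i ∈ range m, (1 - C (q ^ i) * X)

lemma rescale_C (q a : R) : rescale q (C a) = C a := by
  ext n
  rw [coeff_rescale, coeff_C]
  split_ifs with hn <;> simp [hn]

lemma qPoch_succ (q : R) (m : ℕ) : qPoch q (m + 1) = qPoch q m * (1 - C (q ^ m) * X) :=
  prod_range_succ _ _

lemma qPoch_one_mul_mk_one (q : R) : qPoch q 1 * PowerSeries.mk (fun _ => 1) = 1 := by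
  rw [qPoch, prod_range_one, pow_zero, map_one, one_mul, mul_comm]
  exact mk_one_mul_one_sub_eq_one R

lemma one_sub_X_mul_rescale_qPoch (q : R) (m : ℕ) :
    (1 - X) * rescale q (qPoch q m) = qPoch q (m + 1) := by
  simp only [qPoch, prod_range_succ' _ m, map_prod, map_sub, map_one, map_mul, rescale_X]
  rw [mul_comm]
  congr 1
  · refine prod_congr rfl fun i _ => ?_
    rw [rescale_C, ← mul_assoc, ← map_mul, ← pow_succ]
  · simp

end GeneratingSeries

section Insertion

lemma sum_card_filter_gt {α M : Type*} [LinearOrder α] [AddCommMonoid M] (S : Finset α)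
    (f : ℕ → M) : ∑ x ∈ S, f #{y ∈ S | x < y} = ∑ c ∈ range #S, f c := by
  induction S using Finset.induction_on_min with
  | empty => simp
  | insert a S ha ih =>
    have haS : a ∉ S := fun h => lt_irrefl a (ha a h)
    rw [sum_insert haS, card_insert_of_notMem haS, sum_range_succ, add_comm, ← ih]
    congr 1
    · refine sum_congr rfl fun x hx => ?_
      rw [filter_insert, if_neg (ha x hx).not_gt]
    · rw [filter_insert, if_neg (lt_irrefl a), filter_true_of_mem ha]

lemma sum_card_filter_lt {α M : Type*} [LinearOrder α] [AddCommMonoid M] (S : Finset α)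
    (f : ℕ → M) : ∑ x ∈ S, f #{y ∈ S | y < x} = ∑ c ∈ range #S, f c :=
  sum_card_filter_gt (α := αᵒᵈ) S f

variable (r : ℕ) {N : ℕ} (π : Equiv.Perm (Fin N))

lemma sum_rDes (f : Fin N → ℕ) :
    ∑ i ∈ rDes r π, f i
      = ∑ i : Fin N, ∑ j : Fin N, if (j : ℕ) = i + 1 ∧ (π j : ℕ) + r ≤ π i then f i else 0 := by
  rw [rDes, sum_filter]
  refine sum_congr rfl fun i _ => ?_
  split_ifs with h
  · obtain ⟨j, hj, hdes⟩ := h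
    simp only [place, letter] at hj hdes
    rw [sum_eq_single j, if_pos ⟨by omega, by omega⟩]
    · exact fun k _ hk => if_neg fun h => hk (Fin.ext (by omega))
    · exact fun h => absurd (mem_univ j) h
  · refine (sum_eq_zero fun j _ => if_neg fun hj => h ⟨j, ?_, ?_⟩).symm <;>
      simp only [place, letter] <;> omega

lemma card_rInv :
    #(rInv r π)
      = ∑ i, ∑ j, if i < j ∧ (π j : ℕ) < π i ∧ (π i : ℕ) < π j + r then 1 else 0 := by
  rw [rInv, invSet, filter_filter, card_filter, Fintype.sum_prod_type]
  refine sum_congr rfl fun i _ => sum_congr rfl fun j _ => if_congr ?_ rfl rfl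
  simp only [letter]
  omega

lemma sum_rDes_insertLetter_last (f : Fin (N + 1) → ℕ) :
    ∑ i ∈ rDes r (insertLetter (Fin.last N) (Fin.last N) π), f i
      = ∑ i ∈ rDes r π, f i.castSucc := by
  simp only [sum_rDes, Fin.sum_univ_castSucc, insertLetter_self, insertLetter_last_castSucc,
    Fin.succAbove_last, Fin.val_last, Fin.val_castSucc]
  rw [if_neg (by omega), sum_eq_zero fun j _ => if_neg (by omega), add_zero, add_zero]
  refine sum_congr rfl fun i _ => ?_
  rw [if_neg (by omega), add_zero]

lemma sum_rDes_insertLetter_castSucc (y : Fin N) (f : Fin (N + 1) → ℕ) :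
    ∑ i ∈ rDes r (insertLetter y.castSucc (Fin.last N) π), f i
        + ∑ i ∈ rDes r π with i.succ = y.castSucc, f i.castSucc
      = (if (π y : ℕ) + r ≤ N then f y.castSucc else 0)
        + ∑ i ∈ rDes r π, f (y.castSucc.succAbove i) := by
  have hself : ∀ j : Fin N, ((y.castSucc.succAbove j : ℕ) = y + 1 ∧ (π j : ℕ) + r ≤ N)
      ↔ y = j ∧ (π y : ℕ) + r ≤ N := by
    intro j
    rw [val_succAbove, Fin.val_castSucc]
    constructor
    · rintro ⟨h, hj⟩
      obtain rfl : y = j := by split_ifs at h <;> omega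
      exact ⟨rfl, hj⟩
    · rintro ⟨rfl, hj⟩
      simpa using hj
  rw [sum_filter]
  simp only [sum_rDes, Fin.sum_univ_succAbove _ y.castSucc, insertLetter_self,
    insertLetter_succAbove, Fin.succAbove_last, Fin.val_last, Fin.val_castSucc, hself]
  rw [if_neg (by omega), zero_add, add_assoc, ← sum_add_distrib]
  congr 1
  · simp [ite_and]
  refine sum_congr rfl fun i _ => ?_
  rw [if_neg (by omega), zero_add, ← sum_add_distrib]
  refine sum_congr rfl fun j _ => ?_
  by_cases hi : i.succ = y.castSucc
  · have hiy : (i : ℕ) + 1 = y := congrArg Fin.val hi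
    have hsucc : y.castSucc.succAbove i = i.castSucc :=
      Fin.succAbove_of_castSucc_lt _ _ (Fin.castSucc_lt_castSucc_iff.2 (by omega))
    rw [if_pos hi, hsucc, if_neg, zero_add]
    simp only [val_succAbove, Fin.val_castSucc]
    split_ifs <;> omega
  · have hiy : (i : ℕ) + 1 ≠ y := fun h => hi (Fin.ext h)
    simp only [if_neg hi, ite_self, add_zero]
    refine if_congr (and_congr_left fun _ => ?_) rfl rfl
    rw [val_succAbove, val_succAbove, Fin.val_castSucc]
    split_ifs <;> omega

lemma card_rInv_insertLetter (x : Fin (N + 1)) :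
    #(rInv r (insertLetter x (Fin.last N) π))
      = #(rInv r π) + #{j | x ≤ j.castSucc ∧ N < π j + r} := by
  simp only [card_rInv, Fin.sum_univ_succAbove _ x, insertLetter_self, insertLetter_succAbove,
    Fin.succAbove_last, Fin.val_last, Fin.val_castSucc, lt_irrefl, false_and, if_false, zero_add,
    Fin.succAbove_lt_succAbove_iff, Fin.lt_succAbove_iff_le_castSucc, card_filter]
  rw [add_comm]
  congr 1
  · refine sum_congr rfl fun i _ => ?_
    rw [if_neg (by omega), zero_add]
  · refine sum_congr rfl fun j _ => if_congr ?_ rfl rfl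
    omega

/-- The slots of the word of `π` into which a new largest letter can be inserted without changing
the number of `r`-descents. Slot `x` puts the new letter before the place `x`, and the slot
`Fin.last N` puts it at the end. -/
def neutralSlots : Finset (Fin (N + 1)) :=
  {x | rdes r (insertLetter x (Fin.last N) π) = rdes r π}

lemma rdes_insertLetter_castSucc (y : Fin N) :
    rdes r (insertLetter y.castSucc (Fin.last N) π) + #{i ∈ rDes r π | i.succ = y.castSucc}
      = (if (π y : ℕ) + r ≤ N then 1 else 0) + rdes r π := by
  simpa only [rdes, card_eq_sum_ones] using sum_rDes_insertLetter_castSucc r π y fun _ => 1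

lemma last_mem_neutralSlots : Fin.last N ∈ neutralSlots r π := by
  simp only [neutralSlots, mem_filter_univ, rdes, card_eq_sum_ones]
  exact sum_rDes_insertLetter_last r π fun _ => 1

lemma place_lt_of_mem_rDes {i : Fin N} (hi : i ∈ rDes r π) : place i < N := by
  obtain ⟨j, hj, -⟩ := (mem_filter_univ _).1 hi
  simp only [place] at hj ⊢
  omega

variable {r π} in
lemma letter_add_le_of_mem_rDes {i y : Fin N} (hi : i ∈ rDes r π) (hy : i.succ = y.castSucc) :
    (π y : ℕ) + r ≤ N := by
  obtain ⟨j, hj, hdes⟩ := (mem_filter_univ _).1 hi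
  have hiy : (i : ℕ) + 1 = y := congrArg Fin.val hy
  simp only [place, letter] at hj hdes
  obtain rfl : j = y := Fin.ext (by omega)
  omega

lemma ite_castSucc_mem_neutralSlots (y : Fin N) :
    (if y.castSucc ∈ neutralSlots r π then 1 else 0)
      = (if N < π y + r then 1 else 0) + #{i ∈ rDes r π | i.succ = y.castSucc} := by
  have hrec := rdes_insertLetter_castSucc r π y
  have hle : #{i ∈ rDes r π | i.succ = y.castSucc} ≤ 1 := card_le_one.2 fun i hi j hj =>
    Fin.succ_injective _ ((mem_filter.1 hi).2.trans (mem_filter.1 hj).2.symm)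
  have hlow : 0 < #{i ∈ rDes r π | i.succ = y.castSucc} → (π y : ℕ) + r ≤ N := fun h => by
    obtain ⟨i, hi⟩ := card_pos.1 h
    exact letter_add_le_of_mem_rDes (mem_filter.1 hi).1 (mem_filter.1 hi).2
  simp only [neutralSlots, mem_filter_univ]
  split_ifs at hrec ⊢ <;> omega

lemma card_filter_neutralSlots (P : Fin (N + 1) → Prop) [DecidablePred P] :
    #{x ∈ neutralSlots r π | P x}
      = (if P (Fin.last N) then 1 else 0) + #{j : Fin N | P j.castSucc ∧ N < π j + r}
        + #{i ∈ rDes r π | P i.succ} := by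
  have hfiber : #{i ∈ rDes r π | P i.succ}
      = ∑ y : Fin N, if P y.castSucc then #{i ∈ rDes r π | i.succ = y.castSucc} else 0 := by
    rw [card_eq_sum_card_fiberwise (f := Fin.succ) (t := univ) fun _ _ => mem_univ _,
      Fin.sum_univ_castSucc, card_eq_zero.2 (filter_eq_empty_iff.2 fun i hi hlast => ?_), add_zero]
    · refine sum_congr rfl fun y _ => ?_
      rw [filter_filter]
      split_ifs with h
      · exact congrArg card (filter_congr fun i _ => and_iff_right_of_imp fun hi => hi ▸ h)
      · exact card_eq_zero.2 (filter_eq_empty_iff.2 fun i _ hi => h (hi.2 ▸ hi.1))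
    · have hlt := place_lt_of_mem_rDes r π (mem_filter.1 hi).1
      exact hlt.ne (congrArg Fin.val hlast)
  have hmem : #{x ∈ neutralSlots r π | P x}
      = ∑ x, if P x then (if x ∈ neutralSlots r π then 1 else 0) else 0 := by
    simp only [← ite_and, ← card_filter]
    congr 1
    ext x
    simp [and_comm]
  rw [hfiber, hmem, Fin.sum_univ_castSucc, if_pos (last_mem_neutralSlots r π), card_filter,
    add_comm, add_assoc, ← sum_add_distrib]
  congr 1
  refine sum_congr rfl fun y _ => ?_
  rw [ite_castSucc_mem_neutralSlots, ite_and]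
  split_ifs <;> simp

lemma card_neutralSlots {r : ℕ} (hr : 1 ≤ r) :
    #(neutralSlots r π) = rdes r π + min r (N + 1) := by
  have htop : #{j : Fin N | N < π j + r} = min (r - 1) N := by
    rw [card_equiv (π.trans Fin.revPerm) (t := {v : Fin N | (v : ℕ) < r - 1}) fun j => ?_,
      Fin.card_filter_val_lt, min_comm]
    simp only [mem_filter_univ, Equiv.trans_apply, Fin.revPerm_apply, Fin.val_rev]
    omega
  have h := card_filter_neutralSlots r π fun _ => True
  simp only [filter_true, if_true, true_and, htop] at h
  rw [h, rdes]
  omega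

lemma rmaj_insertLetter_last :
    rmaj r (insertLetter (Fin.last N) (Fin.last N) π) = rmaj r π := by
  have hInv : #{j : Fin N | Fin.last N ≤ j.castSucc ∧ N < π j + r} = 0 :=
    card_eq_zero.2 <| filter_eq_empty_iff.2 fun j _ h => (Fin.castSucc_lt_last j).not_ge h.1
  rw [rmaj, rmaj, sum_rDes_insertLetter_last, card_rInv_insertLetter, hInv, add_zero]
  rfl

lemma rmaj_insertLetter_castSucc (y : Fin N) :
    rmaj r (insertLetter y.castSucc (Fin.last N) π)
        + (y : ℕ) * #{i ∈ rDes r π | i.succ = y.castSucc}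
      = rmaj r π + (if (π y : ℕ) + r ≤ N then (y : ℕ) else 0)
        + #{z ∈ neutralSlots r π | y.castSucc < z} := by
  have hdes := sum_rDes_insertLetter_castSucc r π y place
  have hpred : ∑ i ∈ rDes r π with i.succ = y.castSucc, place i.castSucc
      = (y : ℕ) * #{i ∈ rDes r π | i.succ = y.castSucc} := by
    rw [mul_comm, ← smul_eq_mul, ← sum_const]
    exact sum_congr rfl fun i hi => congrArg Fin.val (mem_filter.1 hi).2
  have hshift : ∑ i ∈ rDes r π, place (y.castSucc.succAbove i)
      = ∑ i ∈ rDes r π, place i + #{i ∈ rDes r π | y.castSucc < i.succ} := by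
    rw [card_filter, ← sum_add_distrib]
    refine sum_congr rfl fun i _ => ?_
    simp only [place, val_succAbove, Fin.val_castSucc, Fin.castSucc_lt_succ_iff]
    split_ifs <;> omega
  have hInv : #{j : Fin N | y.castSucc ≤ j.castSucc ∧ N < π j + r}
      = #{j : Fin N | y.castSucc < j.castSucc ∧ N < π j + r}
        + if (π y : ℕ) + r ≤ N then 0 else 1 := by
    have hy : (if (π y : ℕ) + r ≤ N then 0 else 1)
        = ∑ j, if y = j then (if (π j : ℕ) + r ≤ N then 0 else 1) else 0 := by simp
    rw [hy, card_filter, card_filter, ← sum_add_distrib]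
    refine sum_congr rfl fun j _ => ?_
    simp only [Fin.castSucc_le_castSucc_iff, Fin.castSucc_lt_castSucc_iff]
    split_ifs <;> omega
  have hslots := card_filter_neutralSlots r π fun z => y.castSucc < z
  rw [if_pos (Fin.castSucc_lt_last y)] at hslots
  rw [rmaj, rmaj, card_rInv_insertLetter, hInv]
  rw [hpred, hshift] at hdes
  simp only [place, Fin.val_castSucc] at hdes ⊢
  split_ifs at hdes ⊢ <;> omega

lemma rmaj_insertLetter_of_mem {x : Fin (N + 1)} (hx : x ∈ neutralSlots r π) :
    rmaj r (insertLetter x (Fin.last N) π) = rmaj r π + #{z ∈ neutralSlots r π | x < z} := by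
  induction x using Fin.lastCases with
  | last =>
    rw [rmaj_insertLetter_last, card_eq_zero.2 (filter_eq_empty_iff.2 fun z _ => ?_), add_zero]
    exact (Fin.le_last z).not_gt
  | cast y =>
    have h := ite_castSucc_mem_neutralSlots r π y
    have hrec := rmaj_insertLetter_castSucc r π y
    rw [if_pos hx] at h
    split_ifs at h hrec with h₁ h₂
    · omega
    · rw [show #{i ∈ rDes r π | i.succ = y.castSucc} = 0 by omega] at hrec
      omega
    · rw [show #{i ∈ rDes r π | i.succ = y.castSucc} = 1 by omega] at hrec
      omega
    · omega

lemma rmaj_insertLetter_of_notMem {x : Fin (N + 1)} (hx : x ∉ neutralSlots r π) :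
    rmaj r (insertLetter x (Fin.last N) π)
      = rmaj r π + (#(neutralSlots r π) + #{z ∈ (neutralSlots r π)ᶜ | z < x}) := by
  obtain ⟨y, rfl⟩ : ∃ y : Fin N, y.castSucc = x :=
    Fin.exists_castSucc_eq.2 fun h => hx (h ▸ last_mem_neutralSlots r π)
  have hgt : #{z ∈ neutralSlots r π | z < y.castSucc} + #{z ∈ neutralSlots r π | y.castSucc < z}
      = #(neutralSlots r π) := by
    rw [card_filter, card_filter, card_eq_sum_ones, ← sum_add_distrib]
    refine sum_congr rfl fun z hz => ?_
    rcases lt_or_gt_of_ne (ne_of_mem_of_not_mem hz hx) with h | h <;> simp [h, h.not_gt]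
  have hlt : #{z ∈ neutralSlots r π | z < y.castSucc} + #{z ∈ (neutralSlots r π)ᶜ | z < y.castSucc}
      = y := by
    rw [← Fin.val_castSucc y, ← Fin.card_Iio,
      ← card_filter_add_card_filter_not (s := Iio y.castSucc) (· ∈ neutralSlots r π)]
    congr 2 <;> ext z <;> simp [and_comm]
  have h := ite_castSucc_mem_neutralSlots r π y
  have hrec := rmaj_insertLetter_castSucc r π y
  rw [if_neg hx] at h
  rw [show #{i ∈ rDes r π | i.succ = y.castSucc} = 0 by omega] at hrec
  split_ifs at h hrec <;> omega

lemma rdes_insertLetter_of_notMem {x : Fin (N + 1)} (hx : x ∉ neutralSlots r π) :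
    rdes r (insertLetter x (Fin.last N) π) = rdes r π + 1 := by
  obtain ⟨y, rfl⟩ : ∃ y : Fin N, y.castSucc = x :=
    Fin.exists_castSucc_eq.2 fun h => hx (h ▸ last_mem_neutralSlots r π)
  have hne : rdes r (insertLetter y.castSucc (Fin.last N) π) ≠ rdes r π :=
    fun h => hx ((mem_filter_univ _).2 h)
  have h := ite_castSucc_mem_neutralSlots r π y
  have hrec := rdes_insertLetter_castSucc r π y
  rw [if_neg hx] at h
  split_ifs at hrec <;> omega

lemma rdes_add_min_le {r : ℕ} (hr : 1 ≤ r) : rdes r π + min r (N + 1) ≤ N + 1 := by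
  rw [← card_neutralSlots π hr]
  simpa using card_le_univ (neutralSlots r π)

lemma sum_insertLetter_last {M : Type*} [AddCommMonoid M] {r : ℕ} (hr : 1 ≤ r)
    (f : ℕ → ℕ → M) :
    ∑ x, f (rdes r (insertLetter x (Fin.last N) π)) (rmaj r (insertLetter x (Fin.last N) π))
      = ∑ c ∈ range (rdes r π + min r (N + 1)), f (rdes r π) (rmaj r π + c)
        + ∑ c ∈ range (N + 1 - (rdes r π + min r (N + 1))),
            f (rdes r π + 1) (rmaj r π + (rdes r π + min r (N + 1) + c)) := by
  rw [← card_neutralSlots π hr, ← sum_add_sum_compl (neutralSlots r π)]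
  congr 1
  · rw [← sum_card_filter_gt]
    refine sum_congr rfl fun x hx => ?_
    rw [rmaj_insertLetter_of_mem r π hx, (mem_filter_univ x).1 hx]
  · have hcompl : #(neutralSlots r π)ᶜ = N + 1 - #(neutralSlots r π) := by
      rw [card_compl, Fintype.card_fin]
    rw [← hcompl, ← sum_card_filter_lt]
    refine sum_congr rfl fun x hx => ?_
    rw [rmaj_insertLetter_of_notMem r π (mem_compl.1 hx),
      rdes_insertLetter_of_notMem r π (mem_compl.1 hx)]

end Insertion

section MajorIndexSeries

open PowerSeries

variable {R : Type*} [CommRing R] (q : R) {r : ℕ}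

lemma C_one_sub_mul_sum_insertLetter {k a d m : ℕ} (h : k + a ≤ m) :
    C (1 - q) * (∑ c ∈ range (k + a), X ^ k * C (q ^ (d + c))
        + ∑ c ∈ range (m - (k + a)), X ^ (k + 1) * C (q ^ (d + (k + a + c))))
      = (1 - C (q ^ m) * X) * (X ^ k * C (q ^ d))
        - C (q ^ a) * (1 - X) * rescale q (X ^ k * C (q ^ d)) := by
  obtain ⟨e, rfl⟩ := Nat.exists_eq_add_of_le h
  have hgeom : ∀ b, C (1 - q) * C (qNumber q b) = 1 - C (q ^ b) := fun b => by
    rw [← map_mul, one_sub_mul_qNumber, map_sub, map_one]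
  simp only [← mul_sum, ← map_sum, ← add_assoc d, sum_range_pow_add, Nat.add_sub_cancel_left]
  rw [mul_add, map_mul, map_mul, mul_left_comm, mul_left_comm (C (1 - q)), hgeom,
    mul_left_comm (C (1 - q)), mul_left_comm (C (1 - q)), hgeom]
  simp only [map_mul, map_pow, rescale_X, rescale_C]
  ring

lemma C_one_sub_mul_genSeries_rmaj_succ (hr : 1 ≤ r) (N : ℕ) :
    C (1 - q) * genSeries q (rdes r (n := N + 1)) (rmaj r)
      = (1 - C (q ^ (N + 1)) * X) * genSeries q (rdes r (n := N)) (rmaj r)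
        - C (q ^ min r (N + 1)) * (1 - X)
          * rescale q (genSeries q (rdes r (n := N)) (rmaj r)) := by
  simp only [genSeries]
  rw [sum_perm_succ_insertLetter_letter (Fin.last N), map_sum, mul_sum, mul_sum, mul_sum,
    ← sum_sub_distrib]
  refine sum_congr rfl fun π _ => ?_
  rw [sum_insertLetter_last π hr fun k d => X ^ k * C (q ^ d),
    C_one_sub_mul_sum_insertLetter q (rdes_add_min_le π hr)]

lemma C_one_sub_mul_mk_qNumber (a : ℕ) (s : ℕ → R) :
    C (1 - q) * PowerSeries.mk (fun x => qNumber q (x + a) * s x)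
      = PowerSeries.mk s - C (q ^ a) * rescale q (PowerSeries.mk s) := by
  ext x
  rw [coeff_C_mul, map_sub, coeff_C_mul, coeff_rescale, coeff_mk, coeff_mk, ← mul_assoc,
    one_sub_mul_qNumber]
  ring

theorem genSeries_rdes_rmaj [IsDomain R] (hq : q ≠ 1) (hr : 1 ≤ r) (n : ℕ) :
    genSeries q (rdes r (n := n)) (rmaj r)
      = qPoch q (n + 1)
        * PowerSeries.mk fun x => ∏ i ∈ range n, qNumber q (x + min r (i + 1)) := by
  induction n with
  | zero => simp [genSeries, rdes, rmaj, rDes, rInv, invSet, qPoch_one_mul_mk_one]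
  | succ n ih =>
    have hC : (C (1 - q) : R⟦X⟧) ≠ 0 :=
      (map_ne_zero_iff _ C_injective).2 (sub_ne_zero.2 hq.symm)
    set s : ℕ → R := fun x => ∏ i ∈ range n, qNumber q (x + min r (i + 1))
    have hs : ∀ x, ∏ i ∈ range (n + 1), qNumber q (x + min r (i + 1))
        = qNumber q (x + min r (n + 1)) * s x := fun x => by rw [prod_range_succ, mul_comm]
    refine mul_left_cancel₀ hC ?_
    calc C (1 - q) * genSeries q (rdes r) (rmaj r)
        = (1 - C (q ^ (n + 1)) * X) * (qPoch q (n + 1) * PowerSeries.mk s)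
          - C (q ^ min r (n + 1)) * ((1 - X) * rescale q (qPoch q (n + 1)))
            * rescale q (PowerSeries.mk s) := by
          rw [C_one_sub_mul_genSeries_rmaj_succ q hr, ih, map_mul]; ring
      _ = qPoch q (n + 1 + 1) * (PowerSeries.mk s
            - C (q ^ min r (n + 1)) * rescale q (PowerSeries.mk s)) := by
          rw [one_sub_X_mul_rescale_qPoch, qPoch_succ q (n + 1)]; ring
      _ = C (1 - q) * (qPoch q (n + 1 + 1) * PowerSeries.mk fun x =>
            ∏ i ∈ range (n + 1), qNumber q (x + min r (i + 1))) := by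
          simp only [hs]
          rw [← C_one_sub_mul_mk_qNumber, mul_left_comm]

end MajorIndexSeries

section Denert

/-- In the cyclic order of the letters, `u` lies strictly after `v` and before the threshold `T`:
for `v < T` this means `v < u < T`, and otherwise the interval wraps around the largest letter. -/
def CycBetween (T v u : ℕ) : Prop := (v < T ∧ v < u ∧ u < T) ∨ (T ≤ v ∧ (v < u ∨ u < T))

instance (T v u : ℕ) : Decidable (CycBetween T v u) :=
  inferInstanceAs (Decidable (_ ∨ _))

variable {n : ℕ} (τ : ℕ → ℕ) (π : Equiv.Perm (Fin n))

/-- The code total of `π` for the thresholds `τ`: every place `j` contributes the number of earlier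
letters lying cyclically between the letter of `j` and the threshold `τ j`. The places and letters
are counted from `0`. -/
def codeSum : ℕ := ∑ j : Fin n, #{i | i < j ∧ CycBetween (τ j) (π j) (π i)}

/-- The places of `π` whose letter reaches the threshold given by `τ`. -/
def excSet : Finset (Fin n) := {j | τ j ≤ π j}

/-- The number of places `j ≥ L` of `π`, counted from `0`, whose letter reaches the threshold given
by `τ`. -/
def highExc (L : ℕ) (τ : ℕ → ℕ) (π : Equiv.Perm (Fin n)) : ℕ := #{j : Fin n | L ≤ j ∧ τ j ≤ π j}

variable {τ} in
lemma mem_excSet {j : Fin n} : j ∈ excSet τ π ↔ τ j ≤ π j := mem_filter_univ _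

lemma letter_add_card_inv (i : Fin n) :
    (π i : ℕ) + #{j | j < i ∧ π i < π j} = i + #{j | i < j ∧ π j < π i} := by
  have hletter : #{j | π j < π i} = π i := by
    rw [card_equiv π (t := Iio (π i)) fun j => by simp, Fin.card_Iio]
  have hplace : #{j | j < i} = i := by rw [filter_gt_eq_Iio, Fin.card_Iio]
  rw [← hletter, ← hplace]
  simp only [card_filter, ← sum_add_distrib]
  refine sum_congr rfl fun j _ => ?_
  rcases lt_trichotomy j i with h | rfl | h
  · rcases lt_or_gt_of_ne (π.injective.ne h.ne) with h' | h' <;> simp [h, h', h.not_gt, h'.not_gt]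
  · simp
  · simp [h, h.not_gt]

lemma card_code_add (j : Fin n) :
    #{i | i < j ∧ CycBetween (τ j) (π j) (π i)} + #{i | i < j ∧ τ j ≤ π i}
      = #{i | i < j ∧ π j < π i} + if j ∈ excSet τ π then (j : ℕ) else 0 := by
  have hplace : (if j ∈ excSet τ π then (j : ℕ) else 0)
      = ∑ i, if i < j then (if τ j ≤ π j then 1 else 0) else 0 := by
    rw [← sum_filter, filter_gt_eq_Iio, sum_const, Fin.card_Iio]
    simp [mem_excSet]
  rw [hplace]
  simp only [card_filter, ← sum_add_distrib]
  refine sum_congr rfl fun i _ => ?_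
  simp only [CycBetween, Fin.lt_def]
  split_ifs <;> omega

lemma invOn_eq_card_product (S : Finset (Fin n)) :
    invOn π S = #{p ∈ S ×ˢ S | p.1 < p.2 ∧ π p.2 < π p.1} := by
  rw [invOn, invSet, filter_filter]
  congr 1
  ext p
  simp [letter, and_comm]

variable {τ}

lemma invOn_excSet (hτ : Monotone τ) :
    invOn π (excSet τ π) = ∑ i ∈ excSet τ π, #{j | j < i ∧ π i < π j} := by
  rw [invOn_eq_card_product, card_filter, sum_product_right]
  refine sum_congr rfl fun i hi => ?_
  rw [← card_filter]
  congr 1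
  ext j
  simp only [mem_filter, mem_univ, true_and, and_iff_right_iff_imp, mem_excSet] at hi ⊢
  exact fun h => (hτ h.1.le).trans (hi.trans h.2.le)

lemma invOn_compl_excSet (hτ : Monotone τ) :
    invOn π (excSet τ π)ᶜ = ∑ i ∈ (excSet τ π)ᶜ, #{j | i < j ∧ π j < π i} := by
  rw [invOn_eq_card_product, card_filter, sum_product]
  refine sum_congr rfl fun i hi => ?_
  rw [← card_filter]
  congr 1
  ext j
  simp only [mem_filter, mem_univ, true_and, and_iff_right_iff_imp, mem_compl, mem_excSet,
    not_le] at hi ⊢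
  exact fun h => lt_of_lt_of_le (lt_trans h.2 hi) (hτ h.1.le)

lemma codeSum_add_sum (hτ : Monotone τ) :
    codeSum τ π + ∑ i : Fin n, #{j : Fin n | i < j ∧ τ j ≤ π i}
      = ∑ i ∈ excSet τ π, (π i : ℕ) + invOn π (excSet τ π) + invOn π (excSet τ π)ᶜ := by
  have hcode : codeSum τ π + ∑ i : Fin n, #{j : Fin n | i < j ∧ τ j ≤ π i}
      = ∑ i, #{j | i < j ∧ π j < π i} + ∑ i ∈ excSet τ π, (i : ℕ) := by
    have hswap : ∀ p : Fin n → Fin n → Prop, [DecidableRel p] →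
        ∑ i, #{j | p i j} = ∑ j, #{i | p i j} := fun p _ => by
      simp only [card_filter]
      exact sum_comm
    rw [hswap, hswap fun i j => i < j ∧ π j < π i, codeSum, ← sum_add_distrib]
    simp only [card_code_add, sum_add_distrib, sum_ite_mem, univ_inter]
  have hletters : ∑ i ∈ excSet τ π, (π i : ℕ) + ∑ i ∈ excSet τ π, #{j | j < i ∧ π i < π j}
      = ∑ i ∈ excSet τ π, (i : ℕ) + ∑ i ∈ excSet τ π, #{j | i < j ∧ π j < π i} := by
    simp only [← sum_add_distrib, letter_add_card_inv]
  rw [hcode, invOn_excSet π hτ, invOn_compl_excSet π hτ, hletters, add_assoc,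
    sum_add_sum_compl, add_comm]

/-- The threshold, for places and letters counted from `0`, whose excedances are the `g`-gap
`(L + 1)`-level excedances: a letter below `n` reaches it at the place `j` exactly when it is at
least `j + g` and at least `L`. Cutting off at `n` keeps the thresholds in range. -/
def threshold (g L n j : ℕ) : ℕ := min (max (j + g) L) n

lemma monotone_threshold (g L n : ℕ) : Monotone (threshold g L n) := fun _ _ h => by
  simp only [threshold]
  omega

lemma threshold_le_letter {g L : ℕ} (i j : Fin n) :
    threshold g L n j ≤ π i ↔ j + g ≤ π i ∧ L ≤ π i := by
  simp only [threshold]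
  omega

lemma gExcp_eq_excSet (g L : ℕ) : gExcp g (L + 1) π = excSet (threshold g L n) π := by
  ext i
  rw [gExcp, mem_filter_univ, mem_excSet, threshold_le_letter, place, letter]
  omega

theorem gexc_eq_highExc (g L : ℕ) : gexc g (L + 1) π = highExc L (threshold g L n) π := by
  rw [gexc, highExc]
  congr 1
  ext i
  rw [mem_filter_univ, mem_filter_univ, threshold_le_letter, place, letter]
  omega

lemma letter_eq_add_card (g L : ℕ) {i : Fin n} (hi : i ∈ excSet (threshold g L n) π) :
    (π i : ℕ) = i + g + #{j : Fin n | i < j ∧ threshold g L n j ≤ π i} := by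
  rw [mem_excSet, threshold_le_letter] at hi
  have hIoc : ({j : Fin n | i < j ∧ threshold g L n j ≤ π i} : Finset (Fin n))
      = Ioc i ⟨π i - g, by omega⟩ := by
    ext j
    rw [mem_filter_univ, threshold_le_letter, mem_Ioc, Fin.le_def]
    simp only [Fin.lt_def]
    omega
  simp only [hIoc, Fin.card_Ioc]
  omega

theorem gden_eq_codeSum (g L : ℕ) : gden g (L + 1) π = codeSum (threshold g L n) π := by
  have hcode := codeSum_add_sum π (monotone_threshold g L n)
  have houtside : ∀ i ∉ excSet (threshold g L n) π,
      #{j : Fin n | i < j ∧ threshold g L n j ≤ π i} = 0 := fun i hi =>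
    card_eq_zero.2 <| filter_eq_empty_iff.2 fun j _ hj =>
      hi ((mem_excSet π).2 ((monotone_threshold g L n hj.1.le).trans hj.2))
  have hletters : ∑ i ∈ excSet (threshold g L n) π, (π i : ℕ)
      = ∑ i ∈ excSet (threshold g L n) π, (place i + g - 1)
        + ∑ i : Fin n, #{j : Fin n | i < j ∧ threshold g L n j ≤ π i} := by
    rw [← sum_subset (subset_univ _) fun i _ => houtside i, ← sum_add_distrib]
    refine sum_congr rfl fun i hi => ?_
    have hi := letter_eq_add_card π g L hi
    rw [place]
    omega
  rw [gden, gNexcp, gExcp_eq_excSet]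
  omega

end Denert

section DeleteLastLetter

/-- The thresholds `τ` after the letter `v` has been removed and the larger letters have been
lowered by one. -/
def delThreshold (τ : ℕ → ℕ) (v i : ℕ) : ℕ := if v < τ i then τ i - 1 else τ i

lemma delThreshold_of_lt {τ : ℕ → ℕ} {v i : ℕ} (h : v < τ i) :
    delThreshold τ v i = τ i - 1 := if_pos h

lemma delThreshold_of_le {τ : ℕ → ℕ} {v i : ℕ} (h : τ i ≤ v) : delThreshold τ v i = τ i :=
  if_neg h.not_gt

lemma monotone_delThreshold {τ : ℕ → ℕ} (hτ : Monotone τ) (v : ℕ) :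
    Monotone (delThreshold τ v) :=
  fun i j h => by
    have := hτ h
    simp only [delThreshold]
    split_ifs <;> omega

lemma delThreshold_le {τ : ℕ → ℕ} {m v i : ℕ} (hτ : τ i ≤ m + 1) (hv : v ≤ m) :
    delThreshold τ v i ≤ m := by
  rw [delThreshold]
  split_ifs <;> omega

variable (τ : ℕ → ℕ) {m : ℕ}

lemma le_succAbove_iff (v : Fin (m + 1)) (a : Fin m) (i : ℕ) :
    τ i ≤ v.succAbove a ↔ delThreshold τ v i ≤ a := by
  rw [val_succAbove, delThreshold]
  split_ifs <;> omega

lemma cycBetween_succAbove_iff (v : Fin (m + 1)) (a b : Fin m) (i : ℕ) :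
    CycBetween (τ i) (v.succAbove a) (v.succAbove b) ↔ CycBetween (delThreshold τ v i) a b := by
  simp only [CycBetween, val_succAbove, delThreshold]
  split_ifs <;> omega

lemma highExc_insertLetter (L : ℕ) (v : Fin (m + 1)) (π : Equiv.Perm (Fin m)) :
    highExc L τ (insertLetter (Fin.last m) v π)
      = highExc L (delThreshold τ v) π + if L ≤ m ∧ τ m ≤ v then 1 else 0 := by
  simp only [highExc, card_filter, Fin.sum_univ_castSucc, insertLetter_self,
    insertLetter_last_castSucc, Fin.val_last, Fin.val_castSucc, le_succAbove_iff]

lemma codeSum_insertLetter (v : Fin (m + 1)) (π : Equiv.Perm (Fin m)) :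
    codeSum τ (insertLetter (Fin.last m) v π)
      = codeSum (delThreshold τ v) π + #{u : Fin (m + 1) | CycBetween (τ m) v u} := by
  rw [codeSum, codeSum, Fin.sum_univ_castSucc]
  congr 1
  · refine sum_congr rfl fun j _ => ?_
    simp only [card_filter, Fin.sum_univ_castSucc, insertLetter_last_castSucc, Fin.val_castSucc,
      Fin.castSucc_lt_castSucc_iff, cycBetween_succAbove_iff]
    rw [if_neg fun h => (Fin.castSucc_lt_last j).not_gt h.1, add_zero]
  · refine card_equiv (insertLetter (Fin.last m) v π) fun i => ?_
    simp only [mem_filter_univ, insertLetter_self, Fin.val_last, and_iff_right_iff_imp]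
    refine fun h => Fin.lt_last_iff_ne_last.2 ?_
    rintro rfl
    rw [insertLetter_self, CycBetween] at h
    omega

lemma card_cycBetween {T v : ℕ} (hT : T ≤ m + 1) (hv : v ≤ m) :
    #{u : Fin (m + 1) | CycBetween T v u} = if T ≤ v then T + (m - v) else T - 1 - v := by
  rw [card_filter, Fin.sum_univ_eq_sum_range fun u => if CycBetween T v u then 1 else 0,
    ← card_filter]
  split_ifs with h
  · rw [show (range (m + 1)).filter (CycBetween T v) = range T ∪ Ioc v m by
        ext u; simp only [mem_filter, mem_range, mem_union, mem_Ioc, CycBetween]; omega,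
      card_union_of_disjoint, card_range, Nat.card_Ioc]
    rw [disjoint_left]
    simp only [mem_range, mem_Ioc]
    omega
  · rw [show (range (m + 1)).filter (CycBetween T v) = Ioo v T by
        ext u; simp only [mem_filter, mem_range, mem_Ioo, CycBetween]; omega,
      Nat.card_Ioo]
    omega

end DeleteLastLetter

section FerrersProduct

variable {R : Type*} [CommRing R] (q : R)

/-- The product `∏ [x + t k - k]` that Goldman, Joichi and White attach to a Ferrers board with `p`
columns of heights `t 0 ≤ t 1 ≤ ⋯`. The subtraction is truncated, which is harmless: for monotone
`t`, a factor with `x + t k < k` is preceded by one with `x + t k = k`, and that one vanishes. -/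
def ferrersProd (t : ℕ → ℕ) (p x : ℕ) : R := ∏ k ∈ range p, qNumber q (x + t k - k)

variable {t : ℕ → ℕ} {T p x : ℕ}

lemma ferrersProd_succ :
    ferrersProd q t (p + 1) x = ferrersProd q t p x * qNumber q (x + t p - p) :=
  prod_range_succ _ _

lemma ferrersProd_eq_zero {k : ℕ} (hk : k < p) (h : x + t k ≤ k) : ferrersProd q t p x = 0 :=
  prod_eq_zero (mem_range.2 hk) (by rw [Nat.sub_eq_zero_of_le h, qNumber_zero])

lemma ferrersProd_delThreshold_of_le {v : ℕ} (h : ∀ k < p, t k ≤ v) :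
    ferrersProd q (delThreshold t v) p x = ferrersProd q t p x :=
  prod_congr rfl fun k hk => by rw [delThreshold_of_le (h k (mem_range.1 hk))]

lemma qNumber_mul_ferrersProd_pred :
    qNumber q x * (ferrersProd q t p (x - 1) * qNumber q (x + t p - (p + 1)))
      = qNumber q x * ferrersProd q t (p + 1) (x - 1) := by
  cases x with
  | zero => simp
  | succ x =>
    rw [ferrersProd_succ, Nat.add_sub_cancel, show x + 1 + t p - (p + 1) = x + t p - p by omega]

lemma qNumber_mul_ferrersProd_succ {d : ℕ} :
    (qNumber q d + q ^ d * qNumber q (x + t p - (p + 1))) * ferrersProd q t (p + 1) x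
      = qNumber q (x + (t p + d) - (p + 1)) * ferrersProd q t (p + 1) x := by
  rcases le_or_gt (x + t p) p with h | h
  · rw [ferrersProd_eq_zero q p.lt_succ_self h, mul_zero, mul_zero]
  · rw [← qNumber_add]
    congr 2
    omega

lemma sum_pow_mul_ferrersProd_delThreshold (ht : Monotone t) (hT : ∀ k < p, t k ≤ T) :
    ∑ v ∈ range T, q ^ (T - 1 - v) * ferrersProd q (delThreshold t v) p x
        + q ^ T * (qNumber q x * ferrersProd q t p (x - 1))
      = qNumber q (x + T - p) * ferrersProd q t p x := by
  induction p generalizing T with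
  | zero =>
    simp only [ferrersProd, prod_range_zero, mul_one, sum_range_pow_sub, Nat.sub_zero]
    rw [← qNumber_add, add_comm]
  | succ p ih =>
    obtain ⟨d, rfl⟩ := Nat.exists_eq_add_of_le (hT p p.lt_succ_self)
    have hbelow : ∀ v ∈ range (t p),
        q ^ (t p + d - 1 - v) * ferrersProd q (delThreshold t v) (p + 1) x
          = q ^ d * qNumber q (x + t p - (p + 1))
            * (q ^ (t p - 1 - v) * ferrersProd q (delThreshold t v) p x) := fun v hv => by
      rw [mem_range] at hv
      rw [ferrersProd_succ, delThreshold_of_lt hv,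
        show t p + d - 1 - v = d + (t p - 1 - v) by omega,
        show x + (t p - 1) - p = x + t p - (p + 1) by omega, pow_add]
      ring
    have habove : ∀ c ∈ range d,
        q ^ (t p + d - 1 - (t p + c)) * ferrersProd q (delThreshold t (t p + c)) (p + 1) x
          = q ^ (d - 1 - c) * ferrersProd q t (p + 1) x := fun c _ => by
      rw [ferrersProd_delThreshold_of_le q fun k hk =>
          (ht (Nat.le_of_lt_succ hk)).trans (Nat.le_add_right _ _),
        show t p + d - 1 - (t p + c) = d - 1 - c by omega]
    rw [sum_range_add, sum_congr rfl hbelow, sum_congr rfl habove, ← mul_sum, ← sum_mul,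
      sum_range_pow_sub, ← qNumber_mul_ferrersProd_succ, ← qNumber_mul_ferrersProd_pred,
      eq_sub_of_add_eq (ih fun k hk => ht hk.le), ferrersProd_succ, pow_add]
    ring

end FerrersProduct

section DenertSeries

open PowerSeries

variable {R : Type*} [CommRing R] (q : R)

/-- The generating series over `𝔖ₘ` of the number of places at or after `L` whose letter reaches the
threshold given by `τ`, and of the code total for `τ`. -/
noncomputable def codeSeries (L : ℕ) (τ : ℕ → ℕ) (m : ℕ) : R⟦X⟧ :=
  genSeries q (highExc L τ (n := m)) (codeSum τ)

variable {τ : ℕ → ℕ} {L m : ℕ}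

lemma codeSeries_zero : codeSeries q L τ 0 = 1 := by
  simp [codeSeries, genSeries, highExc, codeSum]

lemma codeSeries_succ (hτ : τ m ≤ m + 1) :
    codeSeries q L τ (m + 1)
      = ∑ v ∈ range (τ m), C (q ^ (τ m - 1 - v)) * codeSeries q L (delThreshold τ v) m
        + X ^ (if L ≤ m then 1 else 0) * ∑ v ∈ Ico (τ m) (m + 1),
            C (q ^ (τ m + (m - v))) * codeSeries q L (delThreshold τ v) m := by
  have hterm : ∀ v : Fin (m + 1), ∑ π : Equiv.Perm (Fin m),
      X ^ highExc L τ (insertLetter (Fin.last m) v π)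
          * C (q ^ codeSum τ (insertLetter (Fin.last m) v π))
        = X ^ (if L ≤ m ∧ τ m ≤ v then 1 else 0)
          * (C (q ^ if τ m ≤ v then τ m + (m - v) else τ m - 1 - v)
            * codeSeries q L (delThreshold τ v) m) := fun v => by
    rw [codeSeries, genSeries, mul_sum, mul_sum]
    refine sum_congr rfl fun π _ => ?_
    rw [highExc_insertLetter, codeSum_insertLetter, card_cycBetween hτ (Nat.le_of_lt_succ v.2),
      pow_add, pow_add, map_mul]
    ring
  rw [codeSeries, genSeries, sum_perm_succ_insertLetter_place (Fin.last m)]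
  simp only [hterm]
  rw [Fin.sum_univ_eq_sum_range fun v => X ^ (if L ≤ m ∧ τ m ≤ v then 1 else 0)
      * (C (q ^ if τ m ≤ v then τ m + (m - v) else τ m - 1 - v)
        * codeSeries q L (delThreshold τ v) m),
    ← sum_range_add_sum_Ico _ hτ, mul_sum]
  congr 1
  · refine sum_congr rfl fun v hv => ?_
    have hv := (mem_range.1 hv).not_ge
    rw [if_neg fun h => hv h.2, if_neg hv, pow_zero, one_mul]
  · refine sum_congr rfl fun v hv => ?_
    have hv := (mem_Ico.1 hv).1
    simp only [hv, and_true, if_true]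

lemma sum_Ico_pow_add_sub (T : ℕ) :
    ∑ v ∈ Ico T (m + 1), q ^ (T + (m - v)) = q ^ T * qNumber q (m + 1 - T) := by
  rw [sum_Ico_eq_sum_range, ← sum_range_pow_sub, mul_sum]
  refine sum_congr rfl fun c _ => ?_
  rw [← pow_add]
  congr 2
  omega

lemma one_sub_C_mul_X_mul_mk (c : R) {u v w : ℕ → R} (h₀ : u 0 = v 0)
    (h : ∀ x, u (x + 1) = v (x + 1) + w x + c * u x) :
    (1 - C c * X) * PowerSeries.mk u = PowerSeries.mk v + X * PowerSeries.mk w := by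
  ext x
  rw [sub_mul, one_mul, mul_assoc, map_sub, coeff_C_mul, map_add]
  cases x with
  | zero => simp [h₀]
  | succ x =>
    rw [coeff_succ_X_mul, coeff_succ_X_mul]
    simp only [coeff_mk, h]
    ring

lemma sum_C_mul_mul_mk {ι : Type*} (s : Finset ι) (a : ι → R) (P : R⟦X⟧) (f : ι → ℕ → R) :
    ∑ i ∈ s, C (a i) * (P * PowerSeries.mk (f i))
      = P * PowerSeries.mk fun x => ∑ i ∈ s, a i * f i x := by
  have hmk : PowerSeries.mk (fun x => ∑ i ∈ s, a i * f i x)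
      = ∑ i ∈ s, C (a i) * PowerSeries.mk (f i) := by
    ext x
    simp only [coeff_mk, map_sum, coeff_C_mul]
  rw [hmk, mul_sum]
  exact sum_congr rfl fun i _ => mul_left_comm _ _ _

/-- The product `[x + 1] ⋯ [x + k]` of consecutive `q`-numbers. -/
def risingQ (k x : ℕ) : R := ∏ i ∈ range k, qNumber q (x + i + 1)

lemma qNumber_mul_risingQ_succ (k x : ℕ) :
    qNumber q (x + 1) * risingQ q k (x + 1) = qNumber q (x + k + 1) * risingQ q k x := by
  rw [risingQ, risingQ, mul_comm (qNumber q (x + k + 1)), ← prod_range_succ, prod_range_succ',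
    mul_comm, add_zero]
  refine congrArg (· * _) (prod_congr rfl fun i _ => ?_)
  rw [add_right_comm x 1 i, add_assoc x i 1]

lemma risingQ_succ (k x : ℕ) : risingQ q (k + 1) x = qNumber q (x + k + 1) * risingQ q k x := by
  rw [risingQ, prod_range_succ, mul_comm, risingQ]

theorem codeSeries_of_le (hτ : ∀ i, τ i ≤ m) (hm : m ≤ L) :
    codeSeries q L τ m = qPoch q (m + 1) * PowerSeries.mk (risingQ q m) := by
  induction m generalizing τ with
  | zero =>
    rw [codeSeries_zero, ← qPoch_one_mul_mk_one q]
    rfl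
  | succ m ih =>
    have hdel : ∀ v ≤ m, codeSeries q L (delThreshold τ v) m
        = qPoch q (m + 1) * PowerSeries.mk (risingQ q m) := fun v hv =>
      ih (fun i => delThreshold_le (hτ i) hv) (by omega)
    have hweights : ∑ v ∈ range (τ m), q ^ (τ m - 1 - v)
        + ∑ v ∈ Ico (τ m) (m + 1), q ^ (τ m + (m - v)) = qNumber q (m + 1) := by
      rw [sum_range_pow_sub, sum_Ico_pow_add_sub, ← qNumber_add, Nat.add_sub_cancel' (hτ m)]
    have hstep : (1 - C (q ^ (m + 1)) * X) * PowerSeries.mk (risingQ q (m + 1))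
        = C (qNumber q (m + 1)) * PowerSeries.mk (risingQ q m) := by
      ext x
      rw [sub_mul, one_mul, mul_assoc, map_sub, coeff_C_mul, coeff_C_mul, coeff_mk, coeff_mk]
      cases x with
      | zero => simp [risingQ_succ]
      | succ x =>
        rw [coeff_succ_X_mul, coeff_mk, risingQ_succ, risingQ_succ,
          ← qNumber_mul_risingQ_succ q m x,
          show x + 1 + m + 1 = m + 1 + (x + 1) by omega, qNumber_add]
        ring
    calc codeSeries q L τ (m + 1)
        = C (qNumber q (m + 1)) * (qPoch q (m + 1) * PowerSeries.mk (risingQ q m)) := by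
          rw [codeSeries_succ q (hτ m), if_neg (by omega), pow_zero, one_mul,
            sum_congr rfl fun v hv => by
              rw [hdel v (Nat.le_of_lt_succ ((mem_range.1 hv).trans_le (hτ m)))],
            sum_congr (s₁ := Ico _ _) rfl fun v hv => by
              rw [hdel v (Nat.le_of_lt_succ (mem_Ico.1 hv).2)],
            ← sum_mul, ← sum_mul, ← add_mul, ← map_sum, ← map_sum, ← map_add, hweights]
      _ = qPoch q (m + 2) * PowerSeries.mk (risingQ q (m + 1)) := by
          rw [qPoch_succ q (m + 1), mul_assoc, hstep, mul_left_comm]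

lemma risingQ_mul_ferrersProd_succ {t : ℕ → ℕ} {p x : ℕ} (ht : Monotone t) (hT : t p ≤ L + p + 1) :
    risingQ q L (x + 1) * ferrersProd q t (p + 1) (x + 1)
      = ∑ v ∈ range (t p), q ^ (t p - 1 - v)
            * (risingQ q L (x + 1) * ferrersProd q (delThreshold t v) p (x + 1))
        + ∑ v ∈ Ico (t p) (L + p + 1), q ^ (t p + (L + p - v))
            * (risingQ q L x * ferrersProd q (delThreshold t v) p x)
        + q ^ (L + p + 1) * (risingQ q L x * ferrersProd q t (p + 1) x) := by
  have hbelow := sum_pow_mul_ferrersProd_delThreshold q (T := t p) (p := p) (x := x + 1) ht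
    fun k hk => ht hk.le
  have habove : ∑ v ∈ Ico (t p) (L + p + 1), q ^ (t p + (L + p - v))
        * (risingQ q L x * ferrersProd q (delThreshold t v) p x)
      = q ^ t p * qNumber q (L + p + 1 - t p) * (risingQ q L x * ferrersProd q t p x) := by
    rw [← sum_Ico_pow_add_sub, sum_mul]
    refine sum_congr rfl fun v hv => ?_
    rw [ferrersProd_delThreshold_of_le q fun k hk => (ht hk.le).trans (mem_Ico.1 hv).1]
  have hsplit : qNumber q (x + L + 1) * ferrersProd q t p x
      = qNumber q (L + p + 1 - t p) * ferrersProd q t p x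
        + q ^ (L + p + 1 - t p) * ferrersProd q t (p + 1) x := by
    rw [ferrersProd_succ]
    rcases le_or_gt p (x + t p) with h | h
    · rw [show x + L + 1 = L + p + 1 - t p + (x + t p - p) by omega, qNumber_add]
      ring
    · have hlast := ht (Nat.sub_le p 1)
      rw [ferrersProd_eq_zero q (k := p - 1) (by omega) (by omega)]
      ring
  simp only [mul_left_comm _ (risingQ q L (x + 1)), ← mul_sum]
  rw [habove, eq_sub_of_add_eq hbelow, ferrersProd_succ, Nat.add_sub_cancel]
  linear_combination q ^ t p * ferrersProd q t p x * qNumber_mul_risingQ_succ q L x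
    + q ^ t p * risingQ q L x * hsplit
    + risingQ q L x * ferrersProd q t (p + 1) x * pow_mul_pow_sub q hT

theorem codeSeries_add {p : ℕ} (hmono : Monotone τ) (hτ : ∀ i, τ i ≤ L + p) :
    codeSeries q L τ (L + p) = qPoch q (L + p + 1)
      * PowerSeries.mk fun x => risingQ q L x * ferrersProd q (fun k => τ (L + k)) p x := by
  induction p generalizing τ with
  | zero => simpa [ferrersProd] using codeSeries_of_le q hτ le_rfl
  | succ p ih =>
    set t : ℕ → ℕ := fun k => τ (L + k)
    have ht : Monotone t := fun i j h => hmono (by omega)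
    have hdel : ∀ v ≤ L + p, codeSeries q L (delThreshold τ v) (L + p) = qPoch q (L + p + 1)
        * PowerSeries.mk fun x => risingQ q L x * ferrersProd q (delThreshold t v) p x :=
      fun v hv => ih (monotone_delThreshold hmono v) fun i => delThreshold_le (hτ i) hv
    have hzero : risingQ q L 0 * ferrersProd q t (p + 1) 0 = ∑ v ∈ range (t p),
        q ^ (t p - 1 - v) * (risingQ q L 0 * ferrersProd q (delThreshold t v) p 0) := by
      have h := sum_pow_mul_ferrersProd_delThreshold q (T := t p) (p := p) (x := 0) ht
        fun k hk => ht hk.le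
      rw [qNumber_zero, zero_mul, mul_zero, add_zero] at h
      simp only [mul_left_comm _ (risingQ q L 0), ← mul_sum]
      rw [h, ferrersProd_succ, mul_comm (qNumber q _)]
    rw [← add_assoc, codeSeries_succ q (hτ (L + p)), if_pos (Nat.le_add_right L p), pow_one,
      sum_congr rfl fun v hv => by
        rw [hdel v (Nat.le_of_lt_succ ((mem_range.1 hv).trans_le (hτ _)))],
      sum_congr (s₁ := Ico _ _) rfl fun v hv => by
        rw [hdel v (Nat.le_of_lt_succ (mem_Ico.1 hv).2)],
      sum_C_mul_mul_mk, sum_C_mul_mul_mk, mul_left_comm X, ← mul_add, qPoch_succ q (L + p + 1),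
      mul_assoc]
    congr 1
    exact (one_sub_C_mul_X_mul_mk _ hzero fun x =>
      risingQ_mul_ferrersProd_succ q ht (hτ (L + p))).symm

end DenertSeries

section EulerMahonian

open PowerSeries

variable {R : Type*} [CommRing R] (q : R)

lemma ferrersProd_threshold (g L p x : ℕ) :
    ferrersProd q (fun k => threshold g L (L + p) (L + k)) p x
      = ∏ i ∈ range p, qNumber q (x + min (g + L) (L + i + 1)) := by
  rw [ferrersProd, ← prod_range_reflect]
  refine prod_congr rfl fun i hi => ?_
  have hi := mem_range.1 hi
  rw [threshold]
  congr 1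
  omega

lemma codeSeries_threshold (g L n : ℕ) :
    codeSeries q L (threshold g L n) n = qPoch q (n + 1)
      * PowerSeries.mk fun x => ∏ i ∈ range n, qNumber q (x + min (g + L) (i + 1)) := by
  have hle : ∀ i, threshold g L n i ≤ n := fun i => min_le_right _ _
  have hlow : ∀ k ≤ L, ∀ x,
      ∏ i ∈ range k, qNumber q (x + min (g + L) (i + 1)) = risingQ q k x := fun k hk x =>
    prod_congr rfl fun i hi => by
      rw [min_eq_right (by have := mem_range.1 hi; omega), add_assoc]
  rcases le_total n L with hn | hn
  · simp only [hlow n hn]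
    exact codeSeries_of_le q hle hn
  · obtain ⟨p, rfl⟩ := Nat.exists_eq_add_of_le hn
    simp only [prod_range_add, hlow L le_rfl, ← ferrersProd_threshold]
    exact codeSeries_add q (monotone_threshold g L _) hle

theorem genSeries_gexc_gden [IsDomain R] (hq : q ≠ 1) {g L : ℕ} (hr : 1 ≤ g + L) (n : ℕ) :
    genSeries q (gexc g (L + 1) (n := n)) (gden g (L + 1))
      = genSeries q (rdes (g + L) (n := n)) (rmaj (g + L)) := by
  rw [genSeries_rdes_rmaj q hq hr, ← codeSeries_threshold, codeSeries, genSeries, genSeries]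
  simp only [gexc_eq_highExc, gden_eq_codeSum]

/-- The polynomials in `t` and `q` as power series in `t` over the polynomials in `q`. -/
noncomputable def toSeries : MvPolynomial (Fin 2) ℤ →+* (MvPolynomial (Fin 1) ℤ)⟦X⟧ :=
  Polynomial.coeToPowerSeries.ringHom.comp (MvPolynomial.finSuccEquiv ℤ 1).toRingHom

lemma toSeries_injective : Function.Injective toSeries :=
  (Polynomial.coe_injective _).comp (MvPolynomial.finSuccEquiv ℤ 1).injective

lemma toSeries_jointGenPoly (st₁ st₂ : ∀ {n : ℕ}, Equiv.Perm (Fin n) → ℕ) (n : ℕ) :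
    toSeries (jointGenPoly st₁ st₂ n)
      = genSeries (MvPolynomial.X 0) (st₁ (n := n)) st₂ := by
  have h₀ : toSeries (MvPolynomial.X 0) = X := by
    simp [toSeries, MvPolynomial.finSuccEquiv_X_zero]
  have h₁ : toSeries (MvPolynomial.X 1) = C (MvPolynomial.X 0) := by
    have h := MvPolynomial.finSuccEquiv_X_succ (R := ℤ) (j := (0 : Fin 1))
    rw [Fin.succ_zero_eq_one] at h
    simp [toSeries, h]
  simp only [jointGenPoly, genSeries, map_sum, map_mul, map_pow, h₀, h₁]

end EulerMahonian

theorem mainTheorem1_general (g L : ℕ) (hr : 1 ≤ g + L) :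
    IsEulerMahonian (g + L) (gexc g (L + 1)) (gden g (L + 1)) := by
  intro n
  have hX : (MvPolynomial.X 0 : MvPolynomial (Fin 1) ℤ) ≠ 1 := fun h => by
    simpa using congrArg MvPolynomial.constantCoeff h
  apply toSeries_injective
  rw [toSeries_jointGenPoly, toSeries_jointGenPoly]
  exact genSeries_gexc_gden _ hX hr n

theorem mainTheorem1 (g ℓ : ℕ) (hg : 1 ≤ g) (hℓ : 1 ≤ ℓ) :
    IsEulerMahonian (g + ℓ - 1) (gexc g ℓ) (gden g ℓ) := by
  obtain ⟨L, rfl⟩ := Nat.exists_eq_add_of_le' hℓ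
  exact mainTheorem1_general g L (Nat.le_add_right_of_le hg)
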